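/- Let $a\in\mathbb R$ and $L>0$. Consider the boundary value problem $$u'''+au'+u^2u'=0\ \text{ on } [0,L],\qquad u(0)=u(L)=u'(L)=0,$$ for real-valued functions $u\in C^3[0,L]$. Since $u(0)=u(L)$, such a function is identified with its $L$-periodic extension to $\mathbb R$; the fundamental period of a nontrivial periodic function is its minimal positive period. If $aL^2<4\pi^2$, then there exists a solution $u$, not identically zero, whose fundamental period is $L$, and it is unique up to sign: the solutions with these properties are exactly $u$ and $-u$. If $aL^2\ge 4\pi^2$, then there is no solution, not identically zero, with fundamental period $L$. -/

import Mathlib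

/-- `u` is of class `C³` on the closed interval `[0, L]` (one-sided derivatives at the end points),
satisfies the focusing stationary mKdV equation `u''' + a u' + u² u' = 0` on `[0, L]`,
and the boundary conditions `u(0) = u(L) = u'(L) = 0`.
Only the values of `u` on `[0, L]` matter. -/
structure IsFocusingMKdVStationary (a L : ℝ) (u : ℝ → ℝ) : Prop where
  contDiffOn : ContDiffOn ℝ 3 u (Set.Icc 0 L)
  equation : ∀ x ∈ Set.Icc 0 L,
    iteratedDerivWithin 3 u (Set.Icc 0 L) x + a * derivWithin u (Set.Icc 0 L) x
      + u x ^ 2 * derivWithin u (Set.Icc 0 L) x = 0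
  left_value : u 0 = 0
  right_value : u L = 0
  right_deriv : derivWithin u (Set.Icc 0 L) L = 0

/-- `T` is the fundamental period of `u : ℝ → ℝ`: the minimal positive period. -/
def IsFundamentalPeriod (u : ℝ → ℝ) (T : ℝ) : Prop :=
  IsLeast {P : ℝ | 0 < P ∧ Function.Periodic u P} T

/-- `u` is a nontrivial solution of the boundary value problem on `[0, L]` with fundamental
period `L`. A function on `[0, L]` with equal end values is identified with its unique
`L`-periodic extension to the real line, and `u` is this extension; its regularity and the equation
are required on `[0, L]` only. -/
structure IsFundamentalSolution (a L : ℝ) (u : ℝ → ℝ) : Prop where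
  solution : IsFocusingMKdVStationary a L u
  nontrivial : u ≠ 0
  period : IsFundamentalPeriod u L

/-! Integrating the equation gives `u'' = c - a u - u³/3`, with conserved energy `u'²/2 + a u²/2 +
u⁴/12 - c u`. The conditions at `L` make it vanish, so `u' 0 = 0`: the solution is determined by
`c`, and `c = 0` gives zero. For `c ≠ 0` write `2c = M (a + M²/6)`; then `u'² = u (M - u) (a + (M² +
M u + u²)/6)`. This degenerates at the turning points `0` and `M`, but `u = M (1 - cos θ)/2` turns
it into the regular equation `θ'² = phaseSpeedSq a (M²/6) θ`. So `u` is a wave of period `T(k) =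
phaseTime a k (2π)`, `k = M²/6`.

`T` is strictly decreasing in `k` (`phaseTime_two_pi_lt`), takes every value `L > 0` with `a L² <
4π²` (`exists_phaseTime_two_pi_eq`) and no other (`mul_phaseTime_sq_lt`). Thus `L` fixes `k`, hence
`M` up to sign. -/

open Real Set MeasureTheory Filter

/-! ### Phase speed and phase time -/

/-- The square of the angular speed of the phase `θ` in the parametrization
`u = M (1 - cos θ) / 2` of a periodic solution, where `k = M² / 6`. -/
noncomputable def phaseSpeedSq (a k θ : ℝ) : ℝ :=
  a + k * (1 + (1 - cos θ) / 2 + ((1 - cos θ) / 2) ^ 2)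

/-- The time at which the phase reaches `θ`. -/
noncomputable def phaseTime (a k θ : ℝ) : ℝ := ∫ φ in (0 : ℝ)..θ, (√(phaseSpeedSq a k φ))⁻¹

lemma le_phaseSpeedSq {a k : ℝ} (hk : 0 ≤ k) (θ : ℝ) : a + k ≤ phaseSpeedSq a k θ := by
  unfold phaseSpeedSq
  have h : 0 ≤ (1 - cos θ) / 2 := by linarith [cos_le_one θ]
  nlinarith [mul_nonneg hk h, mul_nonneg hk (sq_nonneg ((1 - cos θ) / 2))]

lemma phaseSpeedSq_pos {a k : ℝ} (hk : 0 ≤ k) (hak : 0 < a + k) (θ : ℝ) :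
    0 < phaseSpeedSq a k θ := hak.trans_le (le_phaseSpeedSq hk θ)

lemma phaseSpeedSq_le {a k : ℝ} (hk : 0 ≤ k) (θ : ℝ) : phaseSpeedSq a k θ ≤ a + 3 * k := by
  unfold phaseSpeedSq
  have h : 0 ≤ (1 - cos θ) / 2 := by linarith [cos_le_one θ]
  have h' : (1 - cos θ) / 2 ≤ 1 := by linarith [neg_one_le_cos θ]
  nlinarith [mul_nonneg hk (sub_nonneg.2 h'), mul_nonneg (mul_nonneg hk h) (sub_nonneg.2 h')]

lemma continuous_phaseSpeedSq (a k : ℝ) : Continuous (phaseSpeedSq a k) := by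
  unfold phaseSpeedSq; fun_prop

lemma phaseSpeedSq_periodic (a k : ℝ) : Function.Periodic (phaseSpeedSq a k) (2 * π) := fun θ ↦ by
  simp [phaseSpeedSq]

lemma continuous_inv_phaseSpeed {a k : ℝ} (hk : 0 ≤ k) (hak : 0 < a + k) :
    Continuous fun θ ↦ (√(phaseSpeedSq a k θ))⁻¹ :=
  (continuous_phaseSpeedSq a k).sqrt.inv₀ fun θ ↦ (sqrt_pos.2 (phaseSpeedSq_pos hk hak θ)).ne'

lemma hasDerivAt_phaseTime {a k : ℝ} (hk : 0 ≤ k) (hak : 0 < a + k) (θ : ℝ) :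
    HasDerivAt (phaseTime a k) (√(phaseSpeedSq a k θ))⁻¹ θ :=
  (continuous_inv_phaseSpeed hk hak).integral_hasStrictDerivAt 0 θ |>.hasDerivAt

lemma strictMono_phaseTime {a k : ℝ} (hk : 0 ≤ k) (hak : 0 < a + k) :
    StrictMono (phaseTime a k) :=
  strictMono_of_deriv_pos fun θ ↦ by
    rw [(hasDerivAt_phaseTime hk hak θ).deriv]
    exact inv_pos.2 (sqrt_pos.2 (phaseSpeedSq_pos hk hak θ))

lemma inv_phaseSpeed_periodic (a k : ℝ) :
    Function.Periodic (fun θ ↦ (√(phaseSpeedSq a k θ))⁻¹) (2 * π) := fun θ ↦ by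
  simp only [phaseSpeedSq_periodic a k θ]

lemma surjective_phaseTime {a k : ℝ} (hk : 0 ≤ k) (hak : 0 < a + k) :
    Function.Surjective (phaseTime a k) := by
  have hc := continuous_inv_phaseSpeed hk hak
  have hpos : ∀ θ, 0 < (√(phaseSpeedSq a k θ))⁻¹ := fun θ ↦
    inv_pos.2 (sqrt_pos.2 (phaseSpeedSq_pos hk hak θ))
  refine Continuous.surjective
    (continuous_iff_continuousAt.2 fun θ ↦ (hasDerivAt_phaseTime hk hak θ).continuousAt) ?_ ?_
  · exact (inv_phaseSpeed_periodic a k).tendsto_atTop_intervalIntegral_of_pos'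
      (hc.intervalIntegrable _ _) hpos two_pi_pos
  · exact (inv_phaseSpeed_periodic a k).tendsto_atBot_intervalIntegral_of_pos'
      (hc.intervalIntegrable _ _) hpos two_pi_pos

lemma phaseTime_zero (a k : ℝ) : phaseTime a k 0 = 0 := by simp [phaseTime]

lemma phaseTime_add_two_pi {a k : ℝ} (hk : 0 ≤ k) (hak : 0 < a + k) (θ : ℝ) :
    phaseTime a k (θ + 2 * π) = phaseTime a k θ + phaseTime a k (2 * π) := by
  have h := (inv_phaseSpeed_periodic a k).intervalIntegral_add_eq_add 0 θ
    fun _ _ ↦ (continuous_inv_phaseSpeed hk hak).intervalIntegrable _ _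
  simpa [phaseTime] using h

lemma phaseTime_int_mul_two_pi {a k : ℝ} (hk : 0 ≤ k) (hak : 0 < a + k) (n : ℤ) :
    phaseTime a k (n * (2 * π)) = n * phaseTime a k (2 * π) := by
  have h := (inv_phaseSpeed_periodic a k).intervalIntegral_add_zsmul_eq n 0
    fun _ _ ↦ (continuous_inv_phaseSpeed hk hak).intervalIntegrable _ _
  simpa [phaseTime] using h

lemma phaseTime_two_pi_pos {a k : ℝ} (hk : 0 ≤ k) (hak : 0 < a + k) :
    0 < phaseTime a k (2 * π) := by
  simpa [phaseTime_zero] using strictMono_phaseTime hk hak two_pi_pos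

/-! ### Dependence of the period on the amplitude -/

/-- The period is a strictly decreasing function of the amplitude. -/
lemma phaseTime_two_pi_lt {a k k' : ℝ} (hk : 0 ≤ k) (hak : 0 < a + k) (hkk : k < k') :
    phaseTime a k' (2 * π) < phaseTime a k (2 * π) := by
  have hlt : ∀ θ, (√(phaseSpeedSq a k' θ))⁻¹ < (√(phaseSpeedSq a k θ))⁻¹ := fun θ ↦ by
    refine inv_strictAnti₀ (sqrt_pos.2 (phaseSpeedSq_pos hk hak θ))
      (sqrt_lt_sqrt (phaseSpeedSq_pos hk hak θ).le ?_)
    unfold phaseSpeedSq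
    have h : 0 ≤ (1 - cos θ) / 2 := by linarith [cos_le_one θ]
    gcongr
  exact intervalIntegral.integral_lt_integral_of_continuousOn_of_le_of_exists_lt two_pi_pos
    (continuous_inv_phaseSpeed (hk.trans hkk.le) (by linarith)).continuousOn
    (continuous_inv_phaseSpeed hk hak).continuousOn (fun θ _ ↦ (hlt θ).le)
    ⟨0, ⟨le_rfl, two_pi_pos.le⟩, hlt 0⟩

lemma phaseTime_two_pi_injOn (a : ℝ) :
    InjOn (fun k ↦ phaseTime a k (2 * π)) {k | 0 ≤ k ∧ 0 < a + k} := by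
  intro k hk k' hk' h
  rcases lt_trichotomy k k' with hlt | heq | hlt
  · exact absurd h (phaseTime_two_pi_lt hk.1 hk.2 hlt).ne'
  · exact heq
  · exact absurd h (phaseTime_two_pi_lt hk'.1 hk'.2 hlt).ne

lemma phaseTime_two_pi_le {a k : ℝ} (hk : 0 ≤ k) (hak : 0 < a + k) :
    phaseTime a k (2 * π) ≤ 2 * π / √(a + k) := by
  have h : phaseTime a k (2 * π) ≤ ∫ _ in (0 : ℝ)..2 * π, (√(a + k))⁻¹ := by
    refine intervalIntegral.integral_mono_on two_pi_pos.le
      ((continuous_inv_phaseSpeed hk hak).intervalIntegrable _ _) (by simp) fun θ _ ↦ ?_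
    have := sqrt_pos.2 hak
    gcongr
    exact le_phaseSpeedSq hk θ
  simpa [div_eq_mul_inv] using h

lemma le_phaseTime_two_pi {a k : ℝ} (hk : 0 ≤ k) (hak : 0 < a + k) :
    2 * π / √(a + 3 * k) ≤ phaseTime a k (2 * π) := by
  have h : ∫ _ in (0 : ℝ)..2 * π, (√(a + 3 * k))⁻¹ ≤ phaseTime a k (2 * π) := by
    refine intervalIntegral.integral_mono_on two_pi_pos.le (by simp)
      ((continuous_inv_phaseSpeed hk hak).intervalIntegrable _ _) fun θ _ ↦ ?_
    have := sqrt_pos.2 (phaseSpeedSq_pos hk hak θ)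
    gcongr
    exact phaseSpeedSq_le hk θ
  simpa [div_eq_mul_inv] using h

/-- For `a < 0` the period must be shown to blow up as `a + k → 0`: the phase then slows down near
`θ = 0`, and this linear bound on the speed makes the passage time logarithmically large. -/
lemma phaseSpeed_le_linear {a k δ K θ : ℝ} (hk : 0 ≤ k) (hδ : 0 ≤ δ) (hK : 0 ≤ K)
    (hδk : a + k = δ ^ 2) (hKk : k / 2 ≤ K ^ 2) (hθ : 0 ≤ θ) :
    √(phaseSpeedSq a k θ) ≤ δ + K * θ := by
  refine sqrt_le_iff.2 ⟨by positivity, ?_⟩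
  have h : 0 ≤ (1 - cos θ) / 2 := by linarith [cos_le_one θ]
  have h' : (1 - cos θ) / 2 ≤ 1 := by linarith [neg_one_le_cos θ]
  have h2 : (1 - cos θ) / 2 ≤ θ ^ 2 / 4 := by linarith [one_sub_sq_div_two_le_cos (x := θ)]
  unfold phaseSpeedSq
  set s := (1 - cos θ) / 2
  have h3 : k * (s + s ^ 2) ≤ k * (θ ^ 2 / 2) := by
    apply mul_le_mul_of_nonneg_left _ hk; nlinarith
  have h4 := mul_le_mul_of_nonneg_right hKk (sq_nonneg θ)
  have h5 : 0 ≤ δ * (K * θ) := by positivity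
  nlinarith

lemma log_le_phaseTime_two_pi {a k δ K : ℝ} (hk : 0 ≤ k) (hδ : 0 < δ) (hK : 0 < K)
    (hδk : a + k = δ ^ 2) (hKk : k / 2 ≤ K ^ 2) :
    log (1 + K * π / δ) / K ≤ phaseTime a k (2 * π) := by
  have hak : 0 < a + k := by rw [hδk]; positivity
  have hpi : phaseTime a k π ≤ phaseTime a k (2 * π) :=
    (strictMono_phaseTime hk hak).monotone (by linarith [pi_pos])
  refine le_trans ?_ hpi
  have hpos : ∀ θ ∈ uIcc 0 π, 0 < δ + K * θ := fun θ hθ ↦ by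
    rw [uIcc_of_le pi_pos.le] at hθ
    have := mul_nonneg hK.le hθ.1
    linarith
  have hcont : ContinuousOn (fun θ ↦ (δ + K * θ)⁻¹) (uIcc 0 π) :=
    ContinuousOn.inv₀ (by fun_prop) fun θ hθ ↦ (hpos θ hθ).ne'
  have hint : ∫ θ in (0 : ℝ)..π, (δ + K * θ)⁻¹ = log (δ + K * π) / K - log (δ + K * 0) / K := by
    refine intervalIntegral.integral_eq_sub_of_hasDerivAt (f := fun θ ↦ log (δ + K * θ) / K)
      (fun θ hθ ↦ ?_) hcont.intervalIntegrable
    have h1 : HasDerivAt (fun θ : ℝ ↦ δ + K * θ) K θ := by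
      simpa using ((hasDerivAt_id θ).const_mul K).const_add δ
    have h2 := (h1.log (hpos θ hθ).ne').div_const K
    refine h2.congr_deriv ?_
    rw [div_right_comm, div_self hK.ne', one_div]
  have hlog : log (1 + K * π / δ) / K = ∫ θ in (0 : ℝ)..π, (δ + K * θ)⁻¹ := by
    rw [hint, ← sub_div, mul_zero, add_zero, ← log_div (by have := pi_pos; positivity) hδ.ne']
    congr 2
    field_simp
  rw [hlog]
  refine intervalIntegral.integral_mono_on pi_pos.le hcont.intervalIntegrable
    ((continuous_inv_phaseSpeed hk hak).intervalIntegrable _ _) fun θ hθ ↦ ?_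
  have := sqrt_pos.2 (phaseSpeedSq_pos hk hak θ)
  gcongr
  exact phaseSpeed_le_linear hk hδ.le hK.le hδk hKk hθ.1

lemma continuousOn_phaseTime_two_pi (a : ℝ) :
    ContinuousOn (fun k ↦ phaseTime a k (2 * π)) {k | 0 < k ∧ 0 < a + k} := by
  rw [continuousOn_iff_continuous_domRestrict]
  refine intervalIntegral.continuous_parametric_intervalIntegral_of_continuous'
    (f := fun (k : {k : ℝ | 0 < k ∧ 0 < a + k}) φ ↦ (√(phaseSpeedSq a k φ))⁻¹) ?_ 0 (2 * π)
  refine Continuous.inv₀ (Continuous.sqrt ?_) ?_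
  · unfold phaseSpeedSq; fun_prop
  · rintro ⟨⟨k, hk⟩, θ⟩
    exact (sqrt_pos.2 (phaseSpeedSq_pos hk.1.le hk.2 θ)).ne'

lemma exists_le_phaseTime_two_pi {a L : ℝ} (hL : 0 < L) (h : a * L ^ 2 < 4 * π ^ 2) :
    ∃ k, 0 < k ∧ 0 < a + k ∧ L ≤ phaseTime a k (2 * π) := by
  rcases le_or_gt 0 a with ha | ha
  -- This `k` solves `a + 3k = (2π/L)²`, so the lower bound on the period is exactly `L`.
  · have hk : 0 < (4 * π ^ 2 - a * L ^ 2) / (3 * L ^ 2) := div_pos (by linarith) (by positivity)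
    refine ⟨_, hk, by positivity, le_trans (le_of_eq ?_) (le_phaseTime_two_pi hk.le (by positivity))⟩
    have : a + 3 * ((4 * π ^ 2 - a * L ^ 2) / (3 * L ^ 2)) = (2 * π / L) ^ 2 := by
      field_simp; ring
    rw [this, sqrt_sq (by positivity)]
    field_simp
  -- With `k = δ² - a` and `δ ≤ 1`, `k/2 ≤ K²`; the second bound on `δ` gives `exp (K L) ≤ K π / δ`.
  · set K := √((1 - a) / 2)
    have hK : 0 < K := sqrt_pos.2 (by linarith)
    have hK2 : K ^ 2 = (1 - a) / 2 := sq_sqrt (by linarith)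
    set δ := min 1 (K * π / exp (K * L))
    have hδ : 0 < δ := lt_min one_pos (by positivity)
    have hδ1 : δ ^ 2 ≤ 1 := pow_le_one₀ hδ.le (min_le_left _ _)
    have hk : 0 < δ ^ 2 - a := by nlinarith
    refine ⟨δ ^ 2 - a, hk, by simpa using by positivity, le_trans ?_
      (log_le_phaseTime_two_pi hk.le hδ hK (by ring) (by rw [hK2]; linarith))⟩
    rw [le_div_iff₀ hK, le_log_iff_exp_le (by positivity)]
    have : exp (K * L) ≤ K * π / δ := by
      rw [le_div_iff₀ hδ, ← le_div_iff₀' (exp_pos _)]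
      exact min_le_right _ _
    rw [mul_comm]
    linarith

/-- Every period smaller than the linear one is attained. -/
lemma exists_phaseTime_two_pi_eq {a L : ℝ} (hL : 0 < L) (h : a * L ^ 2 < 4 * π ^ 2) :
    ∃ k, 0 < k ∧ 0 < a + k ∧ phaseTime a k (2 * π) = L := by
  obtain ⟨k₁, hk₁, hak₁, h₁⟩ := exists_le_phaseTime_two_pi hL h
  -- At this `k`, `a + k = (2π/L)²`, so the upper bound on the period is exactly `L`.
  have hk₂ : 0 < (2 * π / L) ^ 2 - a := by
    rw [div_pow, sub_pos, lt_div_iff₀ (by positivity)]; linarith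
  have hak₂ : a + ((2 * π / L) ^ 2 - a) = (2 * π / L) ^ 2 := by ring
  have hak₂' : 0 < a + ((2 * π / L) ^ 2 - a) := by rw [hak₂]; positivity
  have h₂ := phaseTime_two_pi_le hk₂.le hak₂'
  rw [hak₂, sqrt_sq (by positivity), div_div_cancel₀ (by positivity)] at h₂
  have hsub : uIcc ((2 * π / L) ^ 2 - a) k₁ ⊆ {k | 0 < k ∧ 0 < a + k} := by
    intro k hk
    have hmin := hk.1
    rcases min_choice ((2 * π / L) ^ 2 - a) k₁ with hm | hm <;> rw [hm] at hmin <;>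
      exact ⟨by linarith, by linarith⟩
  obtain ⟨k, hk, hkL⟩ := intermediate_value_uIcc ((continuousOn_phaseTime_two_pi a).mono hsub)
    (Icc_subset_uIcc ⟨h₂, h₁⟩)
  exact ⟨k, (hsub hk).1, (hsub hk).2, hkL⟩

/-- With `T` the period, `a T² < (a + k) T² ≤ 4π²`, by the upper bound on `T`. -/
lemma mul_phaseTime_sq_lt {a k : ℝ} (hk : 0 < k) (hak : 0 < a + k) :
    a * phaseTime a k (2 * π) ^ 2 < 4 * π ^ 2 := by
  have hT := phaseTime_two_pi_pos hk.le hak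
  have h := phaseTime_two_pi_le hk.le hak
  rw [le_div_iff₀ (sqrt_pos.2 hak)] at h
  have h2 := pow_le_pow_left₀ (mul_nonneg hT.le (sqrt_nonneg _)) h 2
  rw [mul_pow, sq_sqrt hak.le] at h2
  have := mul_pos (pow_pos hT 2) hk
  nlinarith

/-! ### The periodic wave -/

/-- The phase at a given time: the inverse function of `phaseTime`. -/
noncomputable def phase (a k : ℝ) : ℝ → ℝ := Function.invFun (phaseTime a k)

/-- The solution of `u'' = c - a u - u³ / 3`, `u 0 = u' 0 = 0`, of amplitude `M`,
where `2 c = M (a + M² / 6)`. -/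
noncomputable def periodicWave (a M x : ℝ) : ℝ := M * (1 - cos (phase a (M ^ 2 / 6) x)) / 2

/-- The derivative of `periodicWave`. -/
noncomputable def periodicWaveDeriv (a M x : ℝ) : ℝ :=
  M / 2 * (sin (phase a (M ^ 2 / 6) x) * √(phaseSpeedSq a (M ^ 2 / 6) (phase a (M ^ 2 / 6) x)))

lemma phaseTime_phase {a k : ℝ} (hk : 0 ≤ k) (hak : 0 < a + k) (x : ℝ) : phaseTime a k (phase a k x) = x :=
  Function.rightInverse_invFun (surjective_phaseTime hk hak) x

lemma phase_phaseTime {a k : ℝ} (hk : 0 ≤ k) (hak : 0 < a + k) (θ : ℝ) : phase a k (phaseTime a k θ) = θ :=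
  Function.leftInverse_invFun (strictMono_phaseTime hk hak).injective θ

lemma continuous_phase {a k : ℝ} (hk : 0 ≤ k) (hak : 0 < a + k) : Continuous (phase a k) := by
  let e := (strictMono_phaseTime hk hak).orderIsoOfSurjective _ (surjective_phaseTime hk hak)
  have h : phase a k = e.symm := funext fun x ↦ by
    rw [OrderIso.eq_symm_apply]
    exact phaseTime_phase hk hak x
  rw [h]
  exact e.symm.continuous

lemma hasDerivAt_phase {a k : ℝ} (hk : 0 ≤ k) (hak : 0 < a + k) (x : ℝ) :
    HasDerivAt (phase a k) (√(phaseSpeedSq a k (phase a k x))) x := by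
  have hpos := inv_pos.2 (sqrt_pos.2 (phaseSpeedSq_pos hk hak (phase a k x)))
  simpa using (hasDerivAt_phaseTime hk hak (phase a k x)).of_local_left_inverse
    (continuous_phase hk hak).continuousAt hpos.ne'
    (Eventually.of_forall (phaseTime_phase hk hak))

lemma phase_zero {a k : ℝ} (hk : 0 ≤ k) (hak : 0 < a + k) : phase a k 0 = 0 := by
  simpa [phaseTime_zero] using phase_phaseTime hk hak 0

lemma phase_add_period {a k : ℝ} (hk : 0 ≤ k) (hak : 0 < a + k) (x : ℝ) :
    phase a k (x + phaseTime a k (2 * π)) = phase a k x + 2 * π := by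
  rw [← phase_phaseTime hk hak (phase a k x + 2 * π), phaseTime_add_two_pi hk hak,
    phaseTime_phase hk hak]

lemma hasDerivAt_phaseSpeedSq (a k θ : ℝ) :
    HasDerivAt (phaseSpeedSq a k) (k * (1 + (1 - cos θ)) * (sin θ / 2)) θ := by
  have h : HasDerivAt (fun θ ↦ (1 - cos θ) / 2) (sin θ / 2) θ := by
    simpa using ((hasDerivAt_cos θ).const_sub 1).div_const 2
  refine ((((h.const_add 1).add (h.pow 2)).const_mul k).const_add a).congr_deriv ?_
  simp; ring

lemma periodicWave_zero {a M : ℝ} (hM : 0 < a + M ^ 2 / 6) : periodicWave a M 0 = 0 := by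
  simp [periodicWave, phase_zero (by positivity : 0 ≤ M ^ 2 / 6) hM]

lemma periodicWaveDeriv_zero {a M : ℝ} (hM : 0 < a + M ^ 2 / 6) : periodicWaveDeriv a M 0 = 0 := by
  simp [periodicWaveDeriv, phase_zero (by positivity : 0 ≤ M ^ 2 / 6) hM]

lemma periodicWave_neg (a M x : ℝ) : periodicWave a (-M) x = -periodicWave a M x := by
  simp only [periodicWave, neg_sq]; ring

lemma periodicWave_periodic {a M : ℝ} (hM : 0 < a + M ^ 2 / 6) :
    Function.Periodic (periodicWave a M) (phaseTime a (M ^ 2 / 6) (2 * π)) := fun x ↦ by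
  simp [periodicWave, phase_add_period (by positivity : 0 ≤ M ^ 2 / 6) hM]

lemma periodicWaveDeriv_periodic {a M : ℝ} (hM : 0 < a + M ^ 2 / 6) :
    Function.Periodic (periodicWaveDeriv a M) (phaseTime a (M ^ 2 / 6) (2 * π)) := fun x ↦ by
  simp [periodicWaveDeriv, phase_add_period (by positivity : 0 ≤ M ^ 2 / 6) hM,
    phaseSpeedSq_periodic a _ _]

/-- The zeros of the wave are the multiples of its period. -/
lemma eq_int_mul_period_of_periodicWave_eq_zero {a M x : ℝ} (hM0 : M ≠ 0)
    (hM : 0 < a + M ^ 2 / 6) (hx : periodicWave a M x = 0) :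
    ∃ n : ℤ, x = n * phaseTime a (M ^ 2 / 6) (2 * π) := by
  have hk : 0 ≤ M ^ 2 / 6 := by positivity
  have hcos : cos (phase a (M ^ 2 / 6) x) = 1 := by
    have : M * (1 - cos (phase a (M ^ 2 / 6) x)) = 0 := by
      unfold periodicWave at hx; linarith
    linarith [(mul_eq_zero.1 this).resolve_left hM0]
  obtain ⟨n, hn⟩ := (cos_eq_one_iff _).1 hcos
  exact ⟨n, by rw [← phaseTime_int_mul_two_pi hk hM, hn, phaseTime_phase hk hM]⟩

/-- Every positive zero of the wave is at least its period. -/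
lemma period_le_of_periodicWave_eq_zero {a M x : ℝ} (hM0 : M ≠ 0)
    (hM : 0 < a + M ^ 2 / 6) (hx0 : 0 < x) (hx : periodicWave a M x = 0) :
    phaseTime a (M ^ 2 / 6) (2 * π) ≤ x := by
  obtain ⟨n, rfl⟩ := eq_int_mul_period_of_periodicWave_eq_zero hM0 hM hx
  have hT := phaseTime_two_pi_pos (by positivity : 0 ≤ M ^ 2 / 6) hM
  have hn : (1 : ℝ) ≤ n := by
    exact_mod_cast (show (0 : ℤ) < n from by exact_mod_cast pos_of_mul_pos_left hx0 hT.le)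
  nlinarith

lemma hasDerivAt_periodicWave {a M : ℝ} (hM : 0 < a + M ^ 2 / 6) (x : ℝ) :
    HasDerivAt (periodicWave a M) (periodicWaveDeriv a M x) x := by
  have h := hasDerivAt_phase (by positivity : 0 ≤ M ^ 2 / 6) hM x
  refine (((h.cos.const_sub 1).const_mul M).div_const 2).congr_deriv ?_
  simp [periodicWaveDeriv]; ring

lemma hasDerivAt_periodicWaveDeriv {a M : ℝ} (hM : 0 < a + M ^ 2 / 6) (x : ℝ) :
    HasDerivAt (periodicWaveDeriv a M)
      (M * (a + M ^ 2 / 6) / 2 - a * periodicWave a M x - periodicWave a M x ^ 3 / 3) x := by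
  have hk : 0 ≤ M ^ 2 / 6 := by positivity
  have h := hasDerivAt_phase hk hM x
  have hpos := phaseSpeedSq_pos hk hM (phase a (M ^ 2 / 6) x)
  have hs := sqrt_pos.2 hpos
  have h2 := ((hasDerivAt_phaseSpeedSq a (M ^ 2 / 6) _).comp x h).sqrt hpos.ne'
  refine ((h.sin.mul h2).const_mul (M / 2)).congr_deriv ?_
  simp only [periodicWave, Function.comp_apply]
  set θ := phase a (M ^ 2 / 6) x
  have hsq := sq_sqrt hpos.le
  have hsc := sin_sq θ
  set g := √(phaseSpeedSq a (M ^ 2 / 6) θ)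
  -- The factor `g = θ'` cancels the `1/g` from differentiating the root; only `g²` and `sin² θ`
  -- remain, so the rest is polynomial in `cos θ`.
  have e : M / 2 * (cos θ * g * g + sin θ * (M ^ 2 / 6 * (1 + (1 - cos θ)) * (sin θ / 2) * g / (2 * g)))
      = M / 2 * (cos θ * g ^ 2 + M ^ 2 / 6 * (1 + (1 - cos θ)) * sin θ ^ 2 / 4) := by
    field_simp
    ring
  rw [e, hsq, hsc]
  unfold phaseSpeedSq
  ring

/-! ### Reduction to an initial value problem -/

/-- Uniqueness for the initial value problem `u'' = c - a u - u³ / 3` on `[0, L]`. -/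
lemma eqOn_of_hasDerivWithinAt_duffing {a c L : ℝ} {u u' v v' : ℝ → ℝ}
    (hu : ∀ x ∈ Icc 0 L, HasDerivWithinAt u (u' x) (Icc 0 L) x)
    (hu' : ∀ x ∈ Icc 0 L, HasDerivWithinAt u' (c - a * u x - u x ^ 3 / 3) (Icc 0 L) x)
    (hv : ∀ x ∈ Icc 0 L, HasDerivWithinAt v (v' x) (Icc 0 L) x)
    (hv' : ∀ x ∈ Icc 0 L, HasDerivWithinAt v' (c - a * v x - v x ^ 3 / 3) (Icc 0 L) x)
    (h0 : u 0 = v 0) (h0' : u' 0 = v' 0) : EqOn u v (Icc 0 L) := by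
  have huc : ContinuousOn u (Icc 0 L) := fun x hx ↦ (hu x hx).continuousWithinAt
  have hvc : ContinuousOn v (Icc 0 L) := fun x hx ↦ (hv x hx).continuousWithinAt
  -- With `p = u - v`, `q = u' - v'` and `r` the bounded function, `(p² + q²)' = 2pqr ≤ C (p² +
  -- q²)`: a Gronwall argument.
  obtain ⟨C, hC⟩ := isCompact_Icc.exists_bound_of_continuousOn
    (f := fun x ↦ 1 - a - (u x ^ 2 + u x * v x + v x ^ 2) / 3) (s := Icc 0 L) (by fun_prop)
  let e : ℝ → ℝ := fun x ↦ ((u x - v x) ^ 2 + (u' x - v' x) ^ 2) * exp (-C * x)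
  have he : ∀ x ∈ Icc 0 L, HasDerivWithinAt e
      ((2 * (u x - v x) * (u' x - v' x) * (1 - a - (u x ^ 2 + u x * v x + v x ^ 2) / 3)
        - C * ((u x - v x) ^ 2 + (u' x - v' x) ^ 2)) * exp (-C * x)) (Icc 0 L) x := fun x hx ↦ by
    have h1 := (((hu x hx).sub (hv x hx)).pow 2).add (((hu' x hx).sub (hv' x hx)).pow 2)
    have h2 : HasDerivWithinAt (fun x ↦ exp (-C * x)) (exp (-C * x) * (-C)) (Icc 0 L) x := by
      simpa using (((hasDerivAt_id x).const_mul (-C)).exp).hasDerivWithinAt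
    refine (h1.mul h2).congr_deriv ?_
    simp; ring
  have hanti : AntitoneOn e (Icc 0 L) := by
    refine antitoneOn_of_hasDerivWithinAt_nonpos (convex_Icc 0 L)
      (fun x hx ↦ (he x hx).continuousWithinAt)
      (fun x hx ↦ (he x (interior_subset hx)).mono interior_subset) fun x hx ↦ ?_
    have hb := abs_le.1 (hC x (interior_subset hx))
    refine mul_nonpos_of_nonpos_of_nonneg ?_ (exp_pos _).le
    set p := u x - v x
    set q := u' x - v' x
    set r := 1 - a - (u x ^ 2 + u x * v x + v x ^ 2) / 3
    -- `2C(p² + q²) - 4pqr = (C - r)(p + q)² + (C + r)(p - q)²`.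
    nlinarith [mul_nonneg (sub_nonneg.2 hb.2) (sq_nonneg (p + q)),
      mul_nonneg (neg_le_iff_add_nonneg'.1 hb.1) (sq_nonneg (p - q))]
  intro x hx
  have h := hanti ⟨le_rfl, hx.1.trans hx.2⟩ hx hx.1
  have h2 : ((u x - v x) ^ 2 + (u' x - v' x) ^ 2) * exp (-C * x) ≤ 0 := by
    simpa [e, h0, h0'] using h
  have h3 : (u x - v x) ^ 2 + (u' x - v' x) ^ 2 ≤ 0 := by
    by_contra! hlt
    exact absurd h2 (not_le.2 (mul_pos hlt (exp_pos _)))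
  have h4 : (u x - v x) ^ 2 = 0 := by nlinarith [sq_nonneg (u x - v x), sq_nonneg (u' x - v' x)]
  exact sub_eq_zero.1 (pow_eq_zero_iff two_ne_zero |>.1 h4)

/-- A solution of the boundary value problem solves an initial value problem of second order with
zero data. -/
lemma IsFocusingMKdVStationary.exists_duffing {a L : ℝ} {u : ℝ → ℝ} (hL : 0 < L)
    (h : IsFocusingMKdVStationary a L u) : ∃ c : ℝ, ∃ u' : ℝ → ℝ,
      (∀ x ∈ Icc 0 L, HasDerivWithinAt u (u' x) (Icc 0 L) x) ∧
      (∀ x ∈ Icc 0 L, HasDerivWithinAt u' (c - a * u x - u x ^ 3 / 3) (Icc 0 L) x) ∧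
      u' 0 = 0 ∧ u' L = 0 := by
  have hU := uniqueDiffOn_Icc hL
  have hmemL : L ∈ Icc 0 L := ⟨hL.le, le_rfl⟩
  have hderiv : ∀ m : ℕ, m < 3 → ∀ x ∈ Icc 0 L, HasDerivWithinAt (iteratedDerivWithin m u (Icc 0 L))
      (iteratedDerivWithin (m + 1) u (Icc 0 L) x) (Icc 0 L) x := fun m hm x hx ↦ by
    rw [iteratedDerivWithin_succ]
    exact (h.contDiffOn.differentiableOn_iteratedDerivWithin (by exact_mod_cast hm) hU x
      hx).hasDerivWithinAt
  have h0 := hderiv 0 (by norm_num)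
  have h1 := hderiv 1 (by norm_num)
  have h2 := hderiv 2 (by norm_num)
  simp only [iteratedDerivWithin_zero, zero_add, Nat.reduceAdd] at h0 h1 h2
  have hone : ∀ x, iteratedDerivWithin 1 u (Icc 0 L) x = derivWithin u (Icc 0 L) x := fun x ↦ by
    rw [iteratedDerivWithin_one]
  set u' := iteratedDerivWithin 1 u (Icc 0 L)
  set u'' := iteratedDerivWithin 2 u (Icc 0 L)
  have hconst : ∀ {f : ℝ → ℝ}, (∀ x ∈ Icc 0 L, HasDerivWithinAt f 0 (Icc 0 L) x) →
      ∀ x ∈ Icc 0 L, f x = f 0 := fun hf ↦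
    constant_of_derivWithin_zero (fun x hx ↦ (hf x hx).differentiableWithinAt)
      fun x hx ↦ (hf x (Ico_subset_Icc_self hx)).derivWithin (hU x (Ico_subset_Icc_self hx))
  have hc := hconst (f := fun x ↦ u'' x + a * u x + u x ^ 3 / 3) fun x hx ↦ by
    have he := h.equation x hx
    rw [← hone] at he
    refine (((h2 x hx).add ((h0 x hx).const_mul a)).add (((h0 x hx).pow 3).div_const 3)).congr_deriv ?_
    refine Eq.trans ?_ he
    simp; ring
  set c := u'' 0 + a * u 0 + u 0 ^ 3 / 3
  have h1' : ∀ x ∈ Icc 0 L, HasDerivWithinAt u' (c - a * u x - u x ^ 3 / 3) (Icc 0 L) x :=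
    fun x hx ↦ (h1 x hx).congr_deriv (by linarith [hc x hx])
  -- The energy vanishes at `L`; at `0` it equals `u' 0 ^ 2 / 2`.
  have hE := hconst (f := fun x ↦ u' x ^ 2 / 2 + a * u x ^ 2 / 2 + u x ^ 4 / 12 - c * u x)
    fun x hx ↦ by
      refine (((((h1' x hx).pow 2).div_const 2).add ((((h0 x hx).pow 2).const_mul a).div_const 2)).add
        (((h0 x hx).pow 4).div_const 12)).sub ((h0 x hx).const_mul c) |>.congr_deriv ?_
      simp; ring
  have hL' : u' L = 0 := by rw [hone, h.right_deriv]
  have hEL := hE L hmemL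
  simp only [h.left_value, h.right_value, hL'] at hEL
  exact ⟨c, u', h0, h1', pow_eq_zero_iff two_ne_zero |>.1 (by linarith), hL'⟩

lemma exists_amplitude_of_pos {c : ℝ} (a : ℝ) (hc : 0 < c) :
    ∃ M : ℝ, 0 < M ∧ M * (a + M ^ 2 / 6) = 2 * c := by
  -- Since `B² ≥ B`, `a + B²/6 ≥ a + |a| + 2c ≥ 2c`, and `B ≥ 1` preserves this after
  -- multiplication.
  set B := 1 + 6 * |a| + 12 * c
  have hB : 1 ≤ B := by have := abs_nonneg a; simp only [B]; linarith
  have hBc : 2 * c ≤ B * (a + B ^ 2 / 6) := by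
    have h1 : 2 * c ≤ a + B ^ 2 / 6 := by
      have h2 : B ≤ B ^ 2 := by nlinarith
      have h3 := neg_abs_le a
      have : B = 1 + 6 * |a| + 12 * c := rfl
      linarith
    nlinarith
  obtain ⟨M, hM, hMc⟩ := intermediate_value_Icc (f := fun M : ℝ ↦ M * (a + M ^ 2 / 6))
    (zero_le_one.trans hB) (by fun_prop) (show 2 * c ∈ _ from ⟨by simp; linarith, hBc⟩)
  refine ⟨M, lt_of_le_of_ne hM.1 ?_, hMc⟩
  rintro rfl
  simp at hMc
  linarith

/-- Positivity of `a + M²/6` is automatic once `M` has the sign of `c`; negative `c` follows by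
oddness in `M`. -/
lemma exists_amplitude {c : ℝ} (a : ℝ) (hc : c ≠ 0) :
    ∃ M : ℝ, M ≠ 0 ∧ 0 < a + M ^ 2 / 6 ∧ M * (a + M ^ 2 / 6) / 2 = c := by
  rcases lt_or_gt_of_ne hc with h | h
  · obtain ⟨M, hM, hMc⟩ := exists_amplitude_of_pos a (neg_pos.2 h)
    exact ⟨-M, by simpa using hM.ne', by rw [neg_sq]; exact pos_of_mul_pos_right (by linarith) hM.le,
      by rw [neg_sq]; linarith⟩
  · obtain ⟨M, hM, hMc⟩ := exists_amplitude_of_pos a h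
    exact ⟨M, hM.ne', pos_of_mul_pos_right (by linarith) hM.le, by linarith⟩

/-! ### Waves are exactly the fundamental solutions -/

lemma contDiff_periodicWave {a M : ℝ} (hM : 0 < a + M ^ 2 / 6) :
    ContDiff ℝ 3 (periodicWave a M) := by
  have hd : deriv (periodicWave a M) = periodicWaveDeriv a M :=
    funext fun x ↦ (hasDerivAt_periodicWave hM x).deriv
  have hd' := funext fun x ↦ (hasDerivAt_periodicWaveDeriv hM x).deriv
  have hD : Differentiable ℝ (periodicWave a M) := fun x ↦
    (hasDerivAt_periodicWave hM x).differentiableAt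
  have hD' : Differentiable ℝ (periodicWaveDeriv a M) := fun x ↦
    (hasDerivAt_periodicWaveDeriv hM x).differentiableAt
  have h1 : ContDiff ℝ 1 (periodicWave a M) :=
    contDiff_one_iff_deriv.2 ⟨hD, hd ▸ hD'.continuous⟩
  rw [show (3 : WithTop ℕ∞) = 2 + 1 by norm_num, contDiff_succ_iff_deriv, hd]
  refine ⟨hD, by simp, ?_⟩
  rw [show (2 : WithTop ℕ∞) = 1 + 1 by norm_num, contDiff_succ_iff_deriv, hd']
  refine ⟨hD', by simp, ?_⟩
  fun_prop

lemma isFundamentalSolution_periodicWave {a M : ℝ} (hM0 : M ≠ 0) (hM : 0 < a + M ^ 2 / 6) :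
    IsFundamentalSolution a (phaseTime a (M ^ 2 / 6) (2 * π)) (periodicWave a M) := by
  have hk : 0 ≤ M ^ 2 / 6 := by positivity
  have hT := phaseTime_two_pi_pos hk hM
  have hper := periodicWave_periodic hM
  have hd : deriv (periodicWave a M) = periodicWaveDeriv a M :=
    funext fun x ↦ (hasDerivAt_periodicWave hM x).deriv
  have hd' := funext fun x ↦ (hasDerivAt_periodicWaveDeriv hM x).deriv
  have hU := uniqueDiffOn_Icc hT
  have hdW : ∀ x ∈ Icc 0 (phaseTime a (M ^ 2 / 6) (2 * π)),
      derivWithin (periodicWave a M) (Icc 0 (phaseTime a (M ^ 2 / 6) (2 * π))) x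
        = periodicWaveDeriv a M x := fun x hx ↦
    (hasDerivAt_periodicWave hM x).hasDerivWithinAt.derivWithin (hU x hx)
  refine ⟨⟨(contDiff_periodicWave hM).contDiffOn, fun x hx ↦ ?_, periodicWave_zero hM, ?_, ?_⟩,
    fun h ↦ ?_, ⟨hT, hper⟩, fun P hP ↦ ?_⟩
  · rw [iteratedDerivWithin_eq_iteratedDeriv hU (contDiff_periodicWave hM).contDiffAt hx, hdW x hx,
      iteratedDeriv_succ, iteratedDeriv_succ, iteratedDeriv_one, hd, hd']
    have h1 := hasDerivAt_periodicWave hM x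
    have h3 := (((h1.const_mul a).const_sub (M * (a + M ^ 2 / 6) / 2)).sub
      ((h1.pow 3).div_const 3)).deriv
    refine (congrArg (fun t ↦ t + a * periodicWaveDeriv a M x
      + periodicWave a M x ^ 2 * periodicWaveDeriv a M x) h3).trans ?_
    simp; ring
  · rw [hper.eq, periodicWave_zero hM]
  · rw [hdW _ ⟨hT.le, le_rfl⟩, (periodicWaveDeriv_periodic hM).eq, periodicWaveDeriv_zero hM]
  -- At phase `π` the wave reaches its extreme value `M ≠ 0`.
  · have h0 : periodicWave a M (phaseTime a (M ^ 2 / 6) π) = 0 := by rw [h]; rfl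
    rw [periodicWave, phase_phaseTime hk hM, cos_pi] at h0
    exact hM0 (by linarith)
  · exact period_le_of_periodicWave_eq_zero hM0 hM hP.1 (by rw [hP.2.eq, periodicWave_zero hM])

lemma Function.Periodic.eq_of_eqOn_Icc {f g : ℝ → ℝ} {T : ℝ} (hT : 0 < T)
    (hf : Function.Periodic f T) (hg : Function.Periodic g T) (h : EqOn f g (Icc 0 T)) : f = g := by
  funext x
  have hx : x - ⌊x / T⌋ • T ∈ Icc 0 T := by
    have h0 := Int.floor_le (x / T)
    have h1 := Int.lt_floor_add_one (x / T)
    rw [le_div_iff₀ hT] at h0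
    rw [div_lt_iff₀ hT] at h1
    rw [zsmul_eq_mul]
    exact ⟨by linarith, by linarith⟩
  rw [← hf.sub_zsmul_eq ⌊x / T⌋, ← hg.sub_zsmul_eq ⌊x / T⌋, h hx]

/-- Every nontrivial solution with fundamental period `L` is a periodic wave of period `L`. -/
lemma IsFundamentalSolution.exists_eq_periodicWave {a L : ℝ} {v : ℝ → ℝ} (hL : 0 < L)
    (hv : IsFundamentalSolution a L v) :
    ∃ M : ℝ, M ≠ 0 ∧ 0 < a + M ^ 2 / 6 ∧ phaseTime a (M ^ 2 / 6) (2 * π) = L ∧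
      v = periodicWave a M := by
  obtain ⟨c, v', h0, h1, hv0, -⟩ := hv.solution.exists_duffing hL
  have hvper : Function.Periodic v L := hv.period.1.2
  by_cases hc : c = 0
  · subst hc
    have hzero : EqOn v 0 (Icc 0 L) := eqOn_of_hasDerivWithinAt_duffing h0 h1
      (v' := 0) (fun x _ ↦ hasDerivWithinAt_const x _ (0 : ℝ))
      (fun x _ ↦ (hasDerivWithinAt_const x _ (0 : ℝ)).congr_deriv (by simp))
      (by simp [hv.solution.left_value]) (by simp [hv0])
    exact absurd (hvper.eq_of_eqOn_Icc hL (g := 0) (fun _ ↦ rfl) hzero) hv.nontrivial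
  obtain ⟨M, hM0, hM, rfl⟩ := exists_amplitude a hc
  have heq : EqOn v (periodicWave a M) (Icc 0 L) := eqOn_of_hasDerivWithinAt_duffing h0 h1
    (fun x _ ↦ (hasDerivAt_periodicWave hM x).hasDerivWithinAt)
    (fun x _ ↦ (hasDerivAt_periodicWaveDeriv hM x).hasDerivWithinAt)
    (by rw [hv.solution.left_value, periodicWave_zero hM]) (by rw [hv0, periodicWaveDeriv_zero hM])
  have hwL : periodicWave a M L = 0 := by
    rw [← heq ⟨hL.le, le_rfl⟩, hv.solution.right_value]
  have hper := periodicWave_periodic hM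
  have hT := phaseTime_two_pi_pos (by positivity : 0 ≤ M ^ 2 / 6) hM
  obtain ⟨n, hn⟩ := eq_int_mul_period_of_periodicWave_eq_zero hM0 hM hwL
  -- `L` is a multiple of the wave's period, so both functions are `L`-periodic and agreement on
  -- `[0, L]` is global. Minimality of `L` then excludes proper multiples.
  have hvw : v = periodicWave a M :=
    hvper.eq_of_eqOn_Icc hL (by rw [hn]; exact hper.int_mul n) heq
  refine ⟨M, hM0, hM, le_antisymm (period_le_of_periodicWave_eq_zero hM0 hM hL hwL) ?_, hvw⟩
  exact hv.period.2 ⟨hT, hvw ▸ hper⟩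

theorem theorem2 (a L : ℝ) (hL : 0 < L) :
    (a * L ^ 2 < 4 * Real.pi ^ 2 →
      ∃ u : ℝ → ℝ, IsFundamentalSolution a L u ∧
        ∀ v : ℝ → ℝ, IsFundamentalSolution a L v ↔ (v = u ∨ v = -u)) ∧
    (4 * Real.pi ^ 2 ≤ a * L ^ 2 → ¬ ∃ u : ℝ → ℝ, IsFundamentalSolution a L u) := by
  refine ⟨fun h ↦ ?_, fun h ⟨u, hu⟩ ↦ ?_⟩
  · obtain ⟨k, hk, hak, hkL⟩ := exists_phaseTime_two_pi_eq hL h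
    obtain ⟨M, hM0, hMk⟩ : ∃ M : ℝ, M ≠ 0 ∧ M ^ 2 / 6 = k :=
      ⟨√(6 * k), (sqrt_pos.2 (by positivity)).ne', by rw [sq_sqrt (by positivity)]; ring⟩
    subst hMk hkL
    have hneg : -periodicWave a M = periodicWave a (-M) :=
      funext fun x ↦ (periodicWave_neg a M x).symm
    refine ⟨_, isFundamentalSolution_periodicWave hM0 hak, fun v ↦ ⟨fun hv ↦ ?_, ?_⟩⟩
    · obtain ⟨N, -, hN, hNL, rfl⟩ := hv.exists_eq_periodicWave hL
      have hsq : N ^ 2 / 6 = M ^ 2 / 6 := phaseTime_two_pi_injOn a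
        ⟨by positivity, hN⟩ ⟨hk.le, hak⟩ hNL
      rcases sq_eq_sq_iff_eq_or_eq_neg.1 (by linarith : N ^ 2 = M ^ 2) with rfl | rfl
      · exact Or.inl rfl
      · exact Or.inr hneg.symm
    · rintro (rfl | rfl)
      · exact isFundamentalSolution_periodicWave hM0 hak
      · rw [hneg]
        simpa using isFundamentalSolution_periodicWave (neg_ne_zero.2 hM0) (by simpa using hak)
  · obtain ⟨M, hM0, hM, rfl, -⟩ := hu.exists_eq_periodicWave hL
    exact absurd h (not_le.2 (mul_phaseTime_sq_lt (by positivity) hM))
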